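/- **Corollary 1.4** (Perron's method, contour passing through a maximum). A *contour* $\mathcal C$ is given by a continuous $c:[0,1]\to\mathbb C$ that is continuously differentiable except at finitely many points and has finite length, and $\int_{\mathcal C} f(z)\,dz:=\int_0^1 f(c(t))c'(t)\,dt$. All complex powers and $\arg$ are principal, with $\arg\in(-\pi,\pi]$. Let $\mathcal B$ be a neighborhood of $z_0\in\mathbb C$, and let $\mathcal C$ be a contour starting at $z_1$, passing exactly once through $z_0$, and ending at $z_2$, where $z_0,z_1,z_2$ are distinct. Let $p$ be holomorphic on a domain containing $\mathcal B\cup\mathcal C$ and not constant on any neighborhood of $z_0$, and write $$p(z)=p(z_0)-p_0(z-z_0)^\mu(1-\phi(z))\qquad(z\in\mathcal B)$$ with $\mu\in\mathbb Z_{\ge1}$, $p_0\in\mathbb C\setminus\{0\}$, $\phi$ holomorphic on $\mathcal B$ and $\phi(z_0)=0$. Suppose that $$\operatorname{Re}p(z)<\operatorname{Re}p(z_0)\quad\text{for all }z\in\mathcal C,\ z\ne z_0.$$ For $\ell\in\mathbb Z$ set $\theta_\ell:=-\frac{\arg p_0}{\mu}+\frac{2\pi\ell}{\mu}$. Let $k_1,k_2\in\mathbb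 Z$ be such that, just before it reaches $z_0$, $\mathcal C$ lies in the sector of angular width $2\pi/\mu$ about $z_0$ with bisecting angle $\theta_{k_1}$, and, just after it leaves $z_0$, $\mathcal C$ lies in the sector of angular width $2\pi/\mu$ about $z_0$ with bisecting angle $\theta_{k_2}$. Then for every integer $S\ge0$ there are constants $C$ and $N_0>0$, such that for every function $q$ holomorphic on a domain containing $\mathcal B\cup\mathcal C$, every $K_q$ with $|q(z)|\le K_q$ on $\mathcal B\cup\mathcal C$, and every real $N\ge N_0$, $$\int_{\mathcal C}e^{N p(z)}q(z)\,dz=e^{N p(z_0)}\left(\sum_{s=0}^{S-1}\Gamma\!\left(\frac{s+1}{\mu}\right)\frac{\alpha_s\left(e^{2\pi i k_2(s+1)/\mu}-e^{2\pi i k_1(s+1)/\mu}\right)}{N^{(s+1)/\mu}}+E\right),\qquad |E|\le \frac{C\,K_q}{N^{(S+1)/\mu}},$$ where $$\alpha_s=\frac{1}{\mu\cdot s!}\,p_0^{-(s+1)/\mu}\,\frac{d^s}{dz^s}\Bigl\{q(z)\,(1-\phi(z))^{-(s+1)/\mu}\Bigr\}_{z=z_0}.$$ In particular $C$ and $N_0$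 do not depend on $q$, $K_q$ or $N$. -/

import Mathlib

open Filter Topology Set

/-- A contour: a continuous map on `[0, 1]` that is continuously differentiable except at finitely
many points, and has finite length (so that integrals along it converge absolutely). -/
structure IsContour (c : ℝ → ℂ) : Prop where
  continuousOn : ContinuousOn c (Icc 0 1)
  contDiffOn : ∃ F : Finset ℝ, ContDiffOn ℝ 1 c (Ioo 0 1 \ (F : Set ℝ))
  integrable_deriv : IntervalIntegrable (deriv c) MeasureTheory.volume 0 1

/-- The integral of `f` along the contour parameterized by `c`. -/
noncomputable def contourIntegral (f : ℂ → ℂ) (c : ℝ → ℂ) : ℂ :=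
  ∫ t in (0 : ℝ)..1, f (c t) * deriv c t

/-- The steepest-descent angle `θ_ℓ = -arg(p₀)/μ + 2πℓ/μ`. -/
noncomputable def steepestAngle (μ : ℕ) (p₀ : ℂ) (l : ℤ) : ℝ :=
  -p₀.arg / μ + 2 * Real.pi * l / μ

/-- The (open) sector about `z₀` of angular width `w` with bisecting angle `α`. -/
def sector (z₀ : ℂ) (α w : ℝ) : Set ℂ :=
  {z | ∃ r θ : ℝ, 0 < r ∧ |θ - α| < w / 2 ∧ z = z₀ + r * Complex.exp (θ * Complex.I)}

/-- The expansion coefficient `α_s`; all powers are principal. -/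
noncomputable def perronCoeff (μ : ℕ) (p₀ : ℂ) (φ q : ℂ → ℂ) (z₀ : ℂ) (s : ℕ) : ℂ :=
  1 / ((μ : ℂ) * (s.factorial : ℂ)) * p₀ ^ (-((s : ℂ) + 1) / (μ : ℂ)) *
    iteratedDeriv s (fun z => q z * (1 - φ z) ^ (-((s : ℂ) + 1) / (μ : ℂ))) z₀

/-! Put `u z = p₀ ^ (1/μ) * (1 - φ z) ^ (1/μ)` and `w = (z - z₀) * u z`. Then `p = p z₀ - w ^ μ` on
`B`, and `w` is a local coordinate with inverse `g`. Near `z₀` the integrand becomes `exp (N * p z₀)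
* exp (-(N * w ^ μ)) * Q w dw` with `Q = (q ∘ g) * g'`. On a disc this has a primitive, so the
middle part of the contour contributes a difference `F w₂ - F w₁` and no path has to be deformed
(`IsContour.integral_eq_primitive_sub`).

Since `Re p` is smaller off `z₀`, `Re (w ^ μ) > 0` at both endpoints; with the sector hypotheses,
this places each one within angle `π / (2μ)` of the ray through `ω = exp (2πik/μ)`
(`exists_polar_of_mem_sector`). An arc of constant modulus leads to that ray at exponentially small
cost, and along the ray the Taylor expansion of `Q` gives Gamma integrals
(`exists_norm_primitive_sub_le`). The values at `0` cancel in the difference. The rest of the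
contour is exponentially small by compactness (`IsContour.exists_norm_integral_le`).

Lagrange inversion (`iteratedDeriv_inversion`) identifies the Taylor coefficients of `Q` with `μ *
α_s`. All errors are linear in a bound for `Q`, hence in `K`, which gives uniformity in `q`. -/

/-! ### Taylor coefficients and inversion -/

/-- Derivatives at `z₀` of a function with a factor `(z - z₀) ^ j`. -/
lemma iteratedDeriv_pow_mul {z₀ : ℂ} {F : ℂ → ℂ} (hF : AnalyticAt ℂ F z₀) (n j : ℕ) :
    iteratedDeriv n (fun z => (z - z₀) ^ j * F z) z₀ =
      (n.choose j * j.factorial : ℂ) * iteratedDeriv (n - j) F z₀ := by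
  have hpow : ∀ i, iteratedDeriv i (fun z => (z - z₀) ^ j) z₀ =
      if i = j then (j.factorial : ℂ) else 0 := by
    intro i
    have := congrFun (iteratedDeriv_comp_sub_const i (fun z : ℂ => z ^ j) z₀) z₀
    rw [this, sub_self, iteratedDeriv_fun_pow_zero]
    simp
  have hX : AnalyticAt ℂ (fun z => (z - z₀) ^ j) z₀ := by fun_prop
  have := iteratedDeriv_mul (n := n) hX.contDiffAt hF.contDiffAt
  change iteratedDeriv n ((fun z => (z - z₀) ^ j) * F) z₀ = _
  rw [this]
  simp_rw [hpow]
  rcases le_or_gt j n with h | h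
  · rw [Finset.sum_eq_single j]
    · simp
    · intro b _ hb; simp [hb]
    · intro hn; exact absurd (Finset.mem_range.2 (by omega)) hn
  · rw [Nat.choose_eq_zero_of_lt h]
    simp only [Nat.cast_zero, zero_mul]
    refine Finset.sum_eq_zero fun b hb => ?_
    have : b ≠ j := by have := Finset.mem_range.1 hb; omega
    simp [this]

lemma hasDerivAt_sub_mul {z₀ z : ℂ} {u : ℂ → ℂ} (hu : DifferentiableAt ℂ u z) :
    HasDerivAt (fun z => (z - z₀) * u z) (u z + (z - z₀) * deriv u z) z := by
  simpa using ((hasDerivAt_id z).sub_const z₀).fun_mul hu.hasDerivAt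

/-- The residue of `w ^ (j - s - 1) dw` vanishes for `j < s`. -/
lemma iteratedDeriv_inversion_lt {z₀ : ℂ} {u : ℂ → ℂ} (hu : AnalyticAt ℂ u z₀) (hu₀ : u z₀ ≠ 0)
    (j k : ℕ) :
    iteratedDeriv (j + (k + 1)) (fun z => ((z - z₀) * u z) ^ j *
      deriv (fun z => (z - z₀) * u z) z * (u z ^ (j + (k + 1) + 1))⁻¹) z₀ = 0 := by
  set f : ℂ → ℂ := fun z => (u z ^ (k + 1))⁻¹ with hf
  have hfa : AnalyticAt ℂ f z₀ := (hu.pow _).inv (pow_ne_zero _ hu₀)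
  -- With `f = u ^ (-(k + 1))`, the term containing `u'` is a multiple of `f'`. Both summands then
  -- have `n`-th derivative at `z₀`, for `n = j + k + 1`, proportional to the `(k + 1)`-st
  -- derivative of `f`.
  have hEq : (fun z => ((z - z₀) * u z) ^ j *
      deriv (fun z => (z - z₀) * u z) z * (u z ^ (j + (k + 1) + 1))⁻¹) =ᶠ[𝓝 z₀]
      (fun z => (z - z₀) ^ j * f z) -
        (fun z => (z - z₀) ^ (j + 1) * ((1 / (k + 1 : ℂ)) * deriv f z)) := by
    filter_upwards [hu.eventually_analyticAt, hu.continuousAt.eventually_ne hu₀] with z hz hz0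
    have h1 := (hz.differentiableAt.hasDerivAt.pow (k + 1)).inv (pow_ne_zero _ hz0)
    have h2 : deriv f z = _ := h1.deriv
    have hk : (k + 1 : ℂ) ≠ 0 := by exact_mod_cast k.succ_ne_zero
    rw [(hasDerivAt_sub_mul hz.differentiableAt).deriv, Pi.sub_apply, h2]
    simp only [hf, Nat.cast_add, Nat.cast_one, Nat.add_sub_cancel, Pi.pow_apply]
    field_simp
    rw [mul_pow]
    ring
  rw [hEq.iteratedDeriv_eq, iteratedDeriv_sub, iteratedDeriv_pow_mul hfa,
    iteratedDeriv_pow_mul (analyticAt_const.fun_mul hfa.deriv), iteratedDeriv_const_mul_field]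
  · have e1 : j + (k + 1) - j = k + 1 := by omega
    have e2 : j + (k + 1) - (j + 1) = k := by omega
    have hk : (k + 1 : ℂ) ≠ 0 := by exact_mod_cast k.succ_ne_zero
    -- This binomial identity makes the two contributions cancel.
    have hc : ((j + (k + 1)).choose (j + 1) * (j + 1) : ℂ) = (j + (k + 1)).choose j * (k + 1) := by
      have := Nat.choose_succ_right_eq (j + (k + 1)) j
      rw [e1] at this
      exact_mod_cast this
    rw [e1, e2, iteratedDeriv_succ', Nat.factorial_succ, sub_eq_zero]
    push_cast
    rw [← mul_assoc, ← mul_assoc, hc]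
    field_simp
  · exact (AnalyticAt.mul (by fun_prop) hfa).contDiffAt
  · exact (AnalyticAt.mul (by fun_prop) (analyticAt_const.fun_mul hfa.deriv)).contDiffAt

/-- The case of residue one, that of `dw / w`: after factoring out `(z - z₀) ^ s`, only the value of
`w' / u` at `z₀` survives, and it is `1`. -/
lemma iteratedDeriv_inversion_eq {z₀ : ℂ} {u : ℂ → ℂ} (hu : AnalyticAt ℂ u z₀) (hu₀ : u z₀ ≠ 0)
    (s : ℕ) :
    iteratedDeriv s (fun z => ((z - z₀) * u z) ^ s *
      deriv (fun z => (z - z₀) * u z) z * (u z ^ (s + 1))⁻¹) z₀ = s.factorial := by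
  have hEq : (fun z => ((z - z₀) * u z) ^ s *
      deriv (fun z => (z - z₀) * u z) z * (u z ^ (s + 1))⁻¹) =ᶠ[𝓝 z₀]
      fun z => (z - z₀) ^ s * (deriv (fun z => (z - z₀) * u z) z * (u z)⁻¹) := by
    filter_upwards [hu.continuousAt.eventually_ne hu₀] with z hz0
    field_simp
    rw [mul_pow]
    ring
  have hw : AnalyticAt ℂ (fun z => (z - z₀) * u z) z₀ := AnalyticAt.mul (by fun_prop) hu
  rw [hEq.iteratedDeriv_eq, iteratedDeriv_pow_mul (hw.deriv.fun_mul (hu.fun_inv hu₀))]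
  simp [(hasDerivAt_sub_mul hu.differentiableAt).deriv, hu₀]

/-- **Lagrange inversion**: if `q = (∑_{j ≤ s} b j * w ^ j + O(w ^ (s + 1))) * w'` with
`w z = (z - z₀) * u z`, then `b s` is the `s`-th Taylor coefficient of `q * u ^ (-(s + 1))`. -/
lemma iteratedDeriv_inversion {z₀ : ℂ} {u q R : ℂ → ℂ} (hu : AnalyticAt ℂ u z₀) (hu₀ : u z₀ ≠ 0)
    (hR : AnalyticAt ℂ R z₀) (b : ℕ → ℂ) (s : ℕ)
    (hq : ∀ᶠ z in 𝓝 z₀, q z = ((∑ j ∈ Finset.range (s + 1), b j * ((z - z₀) * u z) ^ j) +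
      ((z - z₀) * u z) ^ (s + 1) * R z) * deriv (fun z => (z - z₀) * u z) z) :
    iteratedDeriv s (fun z => q z * (u z ^ (s + 1))⁻¹) z₀ = s.factorial * b s := by
  have hw : AnalyticAt ℂ (fun z => (z - z₀) * u z) z₀ := AnalyticAt.mul (by fun_prop) hu
  have hinv : AnalyticAt ℂ (fun z => (u z ^ (s + 1))⁻¹) z₀ :=
    (hu.pow _).inv (pow_ne_zero _ hu₀)
  have hEq : (fun z => q z * (u z ^ (s + 1))⁻¹) =ᶠ[𝓝 z₀]
      (fun z => ∑ j ∈ Finset.range (s + 1), b j * (((z - z₀) * u z) ^ j *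
        deriv (fun z => (z - z₀) * u z) z * (u z ^ (s + 1))⁻¹)) +
      fun z => (z - z₀) ^ (s + 1) * (R z * deriv (fun z => (z - z₀) * u z) z) := by
    filter_upwards [hq, hu.continuousAt.eventually_ne hu₀] with z hz hz0
    rw [hz, Pi.add_apply, add_mul, add_mul, Finset.sum_mul, Finset.sum_mul]
    congr 1
    · exact Finset.sum_congr rfl fun j _ => by ring
    · field_simp
      rw [mul_pow]
      ring
  have hterm : ∀ j, AnalyticAt ℂ (fun z => ((z - z₀) * u z) ^ j *
      deriv (fun z => (z - z₀) * u z) z * (u z ^ (s + 1))⁻¹) z₀ :=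
    fun j => ((hw.pow j).mul hw.deriv).mul hinv
  rw [hEq.iteratedDeriv_eq, iteratedDeriv_add, iteratedDeriv_pow_mul (hR.fun_mul hw.deriv),
    iteratedDeriv_fun_sum, Nat.choose_eq_zero_of_lt (Nat.lt_succ_self s), Finset.sum_eq_single s]
  · rw [iteratedDeriv_const_mul_field, iteratedDeriv_inversion_eq hu hu₀]
    simp [mul_comm]
  · intro j hj hjs
    obtain ⟨k, rfl⟩ : ∃ k, s = j + (k + 1) :=
      ⟨s - j - 1, by have := Finset.mem_range.1 hj; omega⟩
    rw [iteratedDeriv_const_mul_field, iteratedDeriv_inversion_lt hu hu₀, mul_zero]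
  · intro h; simp at h
  · intro j _
    exact (analyticAt_const.mul (hterm j)).contDiffAt
  · exact (Finset.analyticAt_fun_sum _ fun j _ => analyticAt_const.mul (hterm j)).contDiffAt
  · exact (AnalyticAt.mul (by fun_prop) (hR.fun_mul hw.deriv)).contDiffAt

/-! ### Taylor expansion with uniform bounds -/

/-- The `n`-th Taylor remainder at `0` of `Q`, divided by `w ^ n`. -/
noncomputable def taylorQuot (Q : ℂ → ℂ) : ℕ → ℂ → ℂ
  | 0 => Q
  | n + 1 => dslope (taylorQuot Q n) 0

lemma eq_sum_add_taylorQuot (Q : ℂ → ℂ) (n : ℕ) (w : ℂ) :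
    Q w = (∑ j ∈ Finset.range n, taylorQuot Q j 0 * w ^ j) + w ^ n * taylorQuot Q n w := by
  induction n with
  | zero => simp [taylorQuot]
  | succ n ih =>
    have h := sub_smul_dslope (taylorQuot Q n) 0 w
    rw [sub_zero, smul_eq_mul] at h
    rw [Finset.sum_range_succ, taylorQuot, pow_succ, mul_assoc, h, ih]
    ring

lemma differentiableOn_taylorQuot {Q : ℂ → ℂ} {ρ : ℝ} (hρ : 0 < ρ)
    (hQ : DifferentiableOn ℂ Q (Metric.ball 0 ρ)) (n : ℕ) :
    DifferentiableOn ℂ (taylorQuot Q n) (Metric.ball 0 ρ) := by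
  induction n with
  | zero => exact hQ
  | succ n ih => exact (Complex.differentiableOn_dslope (Metric.ball_mem_nhds 0 hρ)).2 ih

/-- By the Schwarz lemma, each division by `w` costs a factor `1 / ρ`; subtracting the value at `0`
costs the factor `2`. The bound is linear in `K` on the whole open disc. -/
lemma norm_taylorQuot_le {Q : ℂ → ℂ} {ρ K : ℝ} (hρ : 0 < ρ)
    (hQ : DifferentiableOn ℂ Q (Metric.ball 0 ρ)) (hK : ∀ w ∈ Metric.ball (0 : ℂ) ρ, ‖Q w‖ ≤ K)
    (n : ℕ) : ∀ w ∈ Metric.ball (0 : ℂ) ρ, ‖taylorQuot Q n w‖ ≤ (2 / ρ) ^ n * K := by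
  induction n with
  | zero => simpa [taylorQuot] using hK
  | succ n ih =>
    intro w hw
    have h := Complex.norm_dslope_le_div_of_mapsTo_ball (R₂ := 2 * ((2 / ρ) ^ n * K))
      (differentiableOn_taylorQuot hρ hQ n) (fun z hz => by
        rw [Metric.mem_closedBall, dist_eq_norm]
        have h1 := ih z hz
        have h2 := ih 0 (Metric.mem_ball_self hρ)
        have h3 := norm_sub_le (taylorQuot Q n z) (taylorQuot Q n 0)
        linarith) hw
    refine h.trans_eq ?_
    rw [pow_succ]
    field_simp

/-! ### Laplace integrals along a ray -/

lemma exists_exp_neg_le_div_rpow {η : ℝ} (hη : 0 < η) (a : ℝ) :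
    ∃ C : ℝ, 0 ≤ C ∧ ∀ N : ℝ, 1 ≤ N → Real.exp (-(N * η)) ≤ C / N ^ a := by
  -- From `x ^ n / n! ≤ exp x` at `x = N * η`, `n = ⌈a⌉₊`; rounding up is harmless as `N ≥ 1`.
  refine ⟨(⌈a⌉₊.factorial : ℝ) / η ^ ⌈a⌉₊, by positivity, fun N hN => ?_⟩
  have hN0 : 0 < N := by linarith
  have h1 : N ^ a ≤ N ^ ⌈a⌉₊ := by
    rw [← Real.rpow_natCast]
    exact Real.rpow_le_rpow_of_exponent_le hN (Nat.le_ceil a)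
  have h2 := Real.pow_div_factorial_le_exp _ (mul_nonneg hN0.le hη.le) ⌈a⌉₊
  rw [div_le_iff₀ (by positivity), mul_pow] at h2
  rw [Real.exp_neg, le_div_iff₀ (by positivity), inv_mul_le_iff₀ (by positivity), ← mul_div_assoc,
    le_div_iff₀ (by positivity)]
  exact (mul_le_mul_of_nonneg_right h1 (by positivity)).trans h2

lemma integrableOn_pow_mul_exp_neg_mul_pow {μ : ℕ} (hμ : 1 ≤ μ) (n : ℕ) {N : ℝ} (hN : 0 < N) :
    MeasureTheory.IntegrableOn (fun r : ℝ => r ^ n * Real.exp (-(N * r ^ μ))) (Ioi 0) := by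
  have hμ' : (0 : ℝ) < μ := by exact_mod_cast hμ
  have hn : (-1 : ℝ) < n := by have : (0 : ℝ) ≤ n := n.cast_nonneg; linarith
  simpa [Real.rpow_natCast] using integrableOn_rpow_mul_exp_neg_mul_rpow hn hμ' hN

lemma integral_pow_mul_exp_neg_mul_pow {μ : ℕ} (hμ : 1 ≤ μ) (n : ℕ) {N : ℝ} (hN : 0 < N) :
    ∫ r in Ioi (0 : ℝ), r ^ n * Real.exp (-(N * r ^ μ)) =
      Real.Gamma (((n : ℝ) + 1) / μ) / μ / N ^ (((n : ℝ) + 1) / μ) := by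
  have hμ' : (0 : ℝ) < μ := by exact_mod_cast hμ
  have hn : (-1 : ℝ) < n := by have : (0 : ℝ) ≤ n := n.cast_nonneg; linarith
  have h := integral_rpow_mul_exp_neg_mul_rpow hμ' hn hN
  simp only [Real.rpow_natCast, neg_mul] at h
  rw [h, neg_div, Real.rpow_neg hN.le]
  field_simp

lemma intervalIntegral_pow_mul_exp_neg_mul_pow_le {μ : ℕ} (hμ : 1 ≤ μ) (n : ℕ) {N δ : ℝ} (hN : 0 < N)
    (hδ : 0 < δ) :
    ∫ r in (0 : ℝ)..δ, r ^ n * Real.exp (-(N * r ^ μ)) ≤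
      Real.Gamma (((n : ℝ) + 1) / μ) / μ / N ^ (((n : ℝ) + 1) / μ) := by
  rw [← integral_pow_mul_exp_neg_mul_pow hμ n hN, intervalIntegral.integral_of_le hδ.le]
  refine MeasureTheory.setIntegral_mono_set (integrableOn_pow_mul_exp_neg_mul_pow hμ n hN) ?_
    (Eventually.of_forall fun x hx => hx.1)
  filter_upwards [MeasureTheory.ae_restrict_mem measurableSet_Ioi] with x hx
  have hx : 0 < x := hx
  positivity

/-- The error is the tail over `r > δ`. Keeping one unit of `N` for convergence and bounding the
other `N - 1` at `r = δ` leaves an integral free of `N`. -/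
lemma abs_intervalIntegral_pow_mul_exp_neg_sub_le {μ : ℕ} (hμ : 1 ≤ μ) (n : ℕ) {N δ : ℝ}
    (hN : 1 ≤ N) (hδ : 0 < δ) :
    |(∫ r in (0 : ℝ)..δ, r ^ n * Real.exp (-(N * r ^ μ))) -
      Real.Gamma (((n : ℝ) + 1) / μ) / μ / N ^ (((n : ℝ) + 1) / μ)| ≤
      Real.exp (-(N * δ ^ μ)) * (Real.exp (δ ^ μ) * (Real.Gamma (((n : ℝ) + 1) / μ) / μ)) := by
  have hN0 : 0 < N := by linarith
  have hi := integrableOn_pow_mul_exp_neg_mul_pow hμ n hN0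
  have hi1 := integrableOn_pow_mul_exp_neg_mul_pow hμ n one_pos
  have hsub : Ioi δ ⊆ Ioi (0 : ℝ) := Ioi_subset_Ioi hδ.le
  have hM := integral_pow_mul_exp_neg_mul_pow hμ n one_pos
  rw [Real.one_rpow, div_one] at hM
  rw [← integral_pow_mul_exp_neg_mul_pow hμ n hN0, ← hM,
    ← intervalIntegral.integral_interval_add_Ioi hi (hi.mono_set hsub), sub_add_cancel_left,
    abs_neg, abs_of_nonneg]
  · calc ∫ r in Ioi δ, r ^ n * Real.exp (-(N * r ^ μ))
        ≤ ∫ r in Ioi δ, Real.exp (-((N - 1) * δ ^ μ)) * (r ^ n * Real.exp (-(1 * r ^ μ))) := by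
          refine MeasureTheory.setIntegral_mono_on (hi.mono_set hsub)
            ((hi1.mono_set hsub).const_mul _) measurableSet_Ioi fun r hr => ?_
          have hr : δ < r := hr
          have h1 : (N - 1) * δ ^ μ ≤ (N - 1) * r ^ μ :=
            mul_le_mul_of_nonneg_left (pow_le_pow_left₀ hδ.le hr.le μ) (by linarith)
          rw [mul_left_comm, ← Real.exp_add]
          refine mul_le_mul_of_nonneg_left (Real.exp_le_exp.2 (by linarith))
            (pow_nonneg (hδ.le.trans hr.le) _)
      _ = Real.exp (-((N - 1) * δ ^ μ)) * ∫ r in Ioi δ, r ^ n * Real.exp (-(1 * r ^ μ)) :=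
          MeasureTheory.integral_const_mul _ _
      _ ≤ Real.exp (-((N - 1) * δ ^ μ)) * ∫ r in Ioi 0, r ^ n * Real.exp (-(1 * r ^ μ)) := by
          refine mul_le_mul_of_nonneg_left ?_ (Real.exp_nonneg _)
          refine MeasureTheory.setIntegral_mono_set hi1 ?_ (Eventually.of_forall hsub)
          filter_upwards [MeasureTheory.ae_restrict_mem measurableSet_Ioi] with x hx
          have hx : 0 < x := hx
          positivity
      _ = _ := by
          rw [show -((N - 1) * δ ^ μ) = -(N * δ ^ μ) + δ ^ μ by ring, Real.exp_add, mul_assoc]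
  · refine MeasureTheory.setIntegral_nonneg measurableSet_Ioi fun r hr => ?_
    have : 0 < r := hδ.trans hr
    positivity

/-- Moving along an arc inside the sector `Re (w ^ μ) > 0` costs an exponentially small amount. -/
lemma norm_primitive_arc_le {μ : ℕ} {ρ δ ψ N K : ℝ} (hδ : 0 < δ) (hδρ : δ < ρ)
    (hψ : |μ * ψ| < Real.pi / 2) {ω : ℂ} (hω : ω ^ μ = 1) (hω' : ‖ω‖ = 1) {Q F : ℂ → ℂ}
    (hK : ∀ w ∈ Metric.ball (0 : ℂ) ρ, ‖Q w‖ ≤ K) (hN : 0 ≤ N)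
    (hF : ∀ w ∈ Metric.ball (0 : ℂ) ρ, HasDerivAt F (Complex.exp (-(N * w ^ μ)) * Q w) w) :
    ‖F (δ * Complex.exp (ψ * Complex.I) * ω) - F (δ * ω)‖ ≤
      Real.exp (-(N * (δ ^ μ * Real.cos (μ * ψ)))) * (δ * |ψ| * K) := by
  set γ : ℝ → ℂ := fun t => δ * Complex.exp ((t * ψ : ℝ) * Complex.I) * ω with hγ
  have hnorm : ∀ t, ‖γ t‖ = δ := fun t => by
    simp [hγ, Complex.norm_exp_ofReal_mul_I, hω', abs_of_pos hδ, -Complex.ofReal_mul]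
  have hmem : ∀ t, γ t ∈ Metric.ball (0 : ℂ) ρ := fun t => by simpa [hnorm] using hδρ
  have hγd : ∀ t, HasDerivAt γ (δ * (Complex.exp ((t * ψ : ℝ) * Complex.I) *
      (ψ * Complex.I)) * ω) t := fun t => by
    have h1 : HasDerivAt (fun t : ℝ => ((t * ψ : ℝ) : ℂ) * Complex.I) (ψ * Complex.I) t := by
      have : HasDerivAt (fun t : ℝ => t * ψ) ψ t := by simpa using (hasDerivAt_id t).mul_const ψ
      exact this.ofReal_comp.mul_const _
    exact (h1.cexp.const_mul _).mul_const _
  have hd : ∀ t, HasDerivAt (fun t => F (γ t)) (Complex.exp (-(N * γ t ^ μ)) * Q (γ t) *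
      (δ * (Complex.exp ((t * ψ : ℝ) * Complex.I) * (ψ * Complex.I)) * ω)) t := fun t =>
    (hF _ (hmem t)).comp t (hγd t)
  have key := norm_image_sub_le_of_norm_deriv_le_segment_01'
    (fun t _ => (hd t).hasDerivWithinAt)
    (C := Real.exp (-(N * (δ ^ μ * Real.cos (μ * ψ)))) * (δ * |ψ| * K)) (fun t ht => ?_)
  · simpa [hγ] using key
  · have hpow : γ t ^ μ = (δ ^ μ : ℝ) * Complex.exp ((μ * (t * ψ) : ℝ) * Complex.I) := by
      simp only [hγ, mul_pow, hω, mul_one, ← Complex.exp_nat_mul]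
      push_cast
      ring_nf
    have hre : (-((N : ℂ) * γ t ^ μ)).re = -(N * (δ ^ μ * Real.cos (μ * (t * ψ)))) := by
      rw [hpow, Complex.neg_re, Complex.re_ofReal_mul, Complex.re_ofReal_mul,
        Complex.exp_ofReal_mul_I_re]
    -- The real part of `w ^ μ` along the arc is smallest at its far end `t = 1`.
    have hcos : Real.cos (μ * ψ) ≤ Real.cos (μ * (t * ψ)) := by
      rw [← Real.cos_abs (μ * ψ), ← Real.cos_abs (μ * (t * ψ))]
      refine Real.cos_le_cos_of_nonneg_of_le_pi (abs_nonneg _) (by linarith [Real.pi_pos]) ?_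
      rw [mul_left_comm, abs_mul t, abs_of_nonneg ht.1]
      exact mul_le_of_le_one_left (abs_nonneg _) ht.2.le
    have hexp : ‖Complex.exp (-(N * γ t ^ μ))‖ ≤ Real.exp (-(N * (δ ^ μ * Real.cos (μ * ψ)))) := by
      rw [Complex.norm_exp, hre]
      gcongr
    have hn3 : ‖(δ : ℂ) * (Complex.exp ((t * ψ : ℝ) * Complex.I) * (ψ * Complex.I)) * ω‖ =
        δ * |ψ| := by
      rw [norm_mul, norm_mul, norm_mul, norm_mul, Complex.norm_exp_ofReal_mul_I, hω']
      simp [abs_of_pos hδ]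
    rw [norm_mul, norm_mul, hn3, mul_assoc, mul_comm (δ * |ψ|)]
    have := hK _ (hmem t)
    gcongr

/-- Expansion of the Laplace integral along the ray through `ω` with `ω ^ μ = 1`. -/
lemma norm_primitive_ray_sub_le {μ : ℕ} (hμ : 1 ≤ μ) {ρ δ N K : ℝ} (hδ : 0 < δ) (hδρ : δ < ρ)
    {ω : ℂ} (hω : ω ^ μ = 1) (hω' : ‖ω‖ = 1) (S : ℕ) {Q F : ℂ → ℂ}
    (hQ : DifferentiableOn ℂ Q (Metric.ball 0 ρ))
    (hK : ∀ w ∈ Metric.ball (0 : ℂ) ρ, ‖Q w‖ ≤ K) (hN : 1 ≤ N)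
    (hF : ∀ w ∈ Metric.ball (0 : ℂ) ρ, HasDerivAt F (Complex.exp (-(N * w ^ μ)) * Q w) w) :
    ‖F (δ * ω) - F 0 - ∑ s ∈ Finset.range S, taylorQuot Q s 0 * ω ^ (s + 1) *
        ((Real.Gamma (((s : ℝ) + 1) / μ) / μ / N ^ (((s : ℝ) + 1) / μ) : ℝ) : ℂ)‖ ≤
      (∑ s ∈ Finset.range S, (2 / ρ) ^ s * K * (Real.exp (-(N * δ ^ μ)) *
        (Real.exp (δ ^ μ) * (Real.Gamma (((s : ℝ) + 1) / μ) / μ)))) +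
      (2 / ρ) ^ S * K * (Real.Gamma (((S : ℝ) + 1) / μ) / μ / N ^ (((S : ℝ) + 1) / μ)) := by
  have hρ : 0 < ρ := hδ.trans hδρ
  have hN0 : 0 < N := by linarith
  have hmem : ∀ r ∈ Icc 0 δ, (r : ℂ) * ω ∈ Metric.ball (0 : ℂ) ρ := fun r hr => by
    simpa [hω', abs_of_nonneg hr.1] using hr.2.trans_lt hδρ
  have hγ : ∀ r : ℝ, HasDerivAt (fun r : ℝ => (r : ℂ) * ω) ω r := fun r => by
    simpa using (Complex.ofRealCLM.hasDerivAt (x := r)).mul_const ω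
  set g : ℕ → ℝ → ℝ := fun s r => r ^ s * Real.exp (-(N * r ^ μ)) with hg
  have hgc : ∀ s, Continuous (g s) := fun s => by simp only [hg]; fun_prop
  -- As `ω ^ μ = 1`, the exponential is real on the ray.
  have hderiv : ∀ r : ℝ, Complex.exp (-(N * ((r : ℂ) * ω) ^ μ)) * Q (r * ω) * ω =
      (∑ s ∈ Finset.range S, taylorQuot Q s 0 * ω ^ (s + 1) * (g s r : ℂ)) +
        ω ^ (S + 1) * (g S r : ℂ) * taylorQuot Q S (r * ω) := fun r => by
    rw [eq_sum_add_taylorQuot Q S (r * ω), mul_pow _ _ μ, hω, mul_one, mul_add, add_mul,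
      Finset.mul_sum, Finset.sum_mul]
    simp only [hg]
    push_cast
    congr 1
    · exact Finset.sum_congr rfl fun s _ => by ring
    · ring
  have hTc : ContinuousOn (fun r : ℝ => taylorQuot Q S (r * ω)) (uIcc 0 δ) := by
    rw [uIcc_of_le hδ.le]
    exact (differentiableOn_taylorQuot hρ hQ S).continuousOn.comp (by fun_prop) hmem
  have hi1 : ∀ s, IntervalIntegrable (fun r => taylorQuot Q s 0 * ω ^ (s + 1) * (g s r : ℂ))
      MeasureTheory.volume 0 δ := fun s =>
    (continuous_const.mul (Complex.continuous_ofReal.comp (hgc s))).intervalIntegrable _ _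
  have hi2 : IntervalIntegrable (fun r => ω ^ (S + 1) * (g S r : ℂ) * taylorQuot Q S (r * ω))
      MeasureTheory.volume 0 δ :=
    ((continuous_const.mul (Complex.continuous_ofReal.comp (hgc S))).continuousOn.mul
      hTc).intervalIntegrable
  have hsum : IntervalIntegrable (fun r => ∑ s ∈ Finset.range S,
      taylorQuot Q s 0 * ω ^ (s + 1) * (g s r : ℂ)) MeasureTheory.volume 0 δ :=
    (continuous_finsetSum _ fun s _ =>
      continuous_const.mul (Complex.continuous_ofReal.comp (hgc s))).intervalIntegrable _ _
  have hftc := intervalIntegral.integral_eq_sub_of_hasDerivAt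
    (f := fun r : ℝ => F (r * ω)) (a := 0) (b := δ) (fun r hr => by
      rw [uIcc_of_le hδ.le] at hr
      have := (hF _ (hmem r hr)).comp r (hγ r)
      rw [hderiv] at this
      exact this) (hsum.add hi2)
  rw [Complex.ofReal_zero, zero_mul] at hftc
  rw [← hftc, intervalIntegral.integral_add hsum hi2,
    intervalIntegral.integral_finsetSum (fun s _ => hi1 s), add_sub_right_comm,
    ← Finset.sum_sub_distrib]
  refine (norm_add_le _ _).trans (add_le_add ((norm_sum_le _ _).trans
    (Finset.sum_le_sum fun s _ => ?_)) ?_)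
  · rw [intervalIntegral.integral_const_mul, intervalIntegral.integral_ofReal, ← mul_sub,
      ← Complex.ofReal_sub, norm_mul, norm_mul, norm_pow, hω', one_pow, mul_one,
      Complex.norm_real, Real.norm_eq_abs]
    have h1 := norm_taylorQuot_le hρ hQ hK s 0 (Metric.mem_ball_self hρ)
    have h2 := abs_intervalIntegral_pow_mul_exp_neg_sub_le hμ s hN hδ
    exact mul_le_mul h1 h2 (abs_nonneg _) ((norm_nonneg _).trans h1)
  · have hK0 : 0 ≤ (2 / ρ) ^ S * K :=
      (norm_nonneg _).trans (norm_taylorQuot_le hρ hQ hK S 0 (Metric.mem_ball_self hρ))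
    have h := intervalIntegral.norm_integral_le_of_norm_le hδ.le
      (f := fun r => ω ^ (S + 1) * (g S r : ℂ) * taylorQuot Q S (r * ω))
      (g := fun r => (2 / ρ) ^ S * K * g S r) (μ := MeasureTheory.volume)
      (Eventually.of_forall fun r hr => by
        have hg0 : 0 ≤ g S r := by have := hr.1; simp only [hg]; positivity
        rw [norm_mul, norm_mul, norm_pow, hω', one_pow, one_mul, Complex.norm_real,
          Real.norm_of_nonneg hg0, mul_comm]
        exact mul_le_mul_of_nonneg_right
          (norm_taylorQuot_le hρ hQ hK S _ (hmem r ⟨hr.1.le, hr.2⟩)) hg0)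
      ((continuous_const.mul (hgc S)).intervalIntegrable _ _)
    refine h.trans ?_
    rw [intervalIntegral.integral_const_mul]
    exact mul_le_mul_of_nonneg_left (intervalIntegral_pow_mul_exp_neg_mul_pow_le hμ S hN0 hδ) hK0

/-- Expansion of the Laplace integral from `0` to a point of a sector where `Re (w ^ μ) > 0`. -/
lemma exists_norm_primitive_sub_le {μ : ℕ} (hμ : 1 ≤ μ) {ρ δ ψ : ℝ} (hδ : 0 < δ) (hδρ : δ < ρ)
    (hψ : |μ * ψ| < Real.pi / 2) {ω : ℂ} (hω : ω ^ μ = 1) (hω' : ‖ω‖ = 1) (S : ℕ) :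
    ∃ C : ℝ, ∀ (Q F : ℂ → ℂ) (K N : ℝ), DifferentiableOn ℂ Q (Metric.ball 0 ρ) →
      (∀ w ∈ Metric.ball (0 : ℂ) ρ, ‖Q w‖ ≤ K) → 1 ≤ N →
      (∀ w ∈ Metric.ball (0 : ℂ) ρ, HasDerivAt F (Complex.exp (-(N * w ^ μ)) * Q w) w) →
      ‖F (δ * Complex.exp (ψ * Complex.I) * ω) - F 0 -
        ∑ s ∈ Finset.range S, taylorQuot Q s 0 * ω ^ (s + 1) *
        ((Real.Gamma (((s : ℝ) + 1) / μ) / μ / N ^ (((s : ℝ) + 1) / μ) : ℝ) : ℂ)‖ ≤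
      C * (K / N ^ (((S : ℝ) + 1) / μ)) := by
  have hcos : 0 < Real.cos (μ * ψ) := Real.cos_pos_of_mem_Ioo (abs_lt.1 hψ)
  obtain ⟨C₁, -, h₁⟩ := exists_exp_neg_le_div_rpow (mul_pos (pow_pos hδ μ) hcos)
    (((S : ℝ) + 1) / μ)
  obtain ⟨C₂, -, h₂⟩ := exists_exp_neg_le_div_rpow (pow_pos hδ μ) (((S : ℝ) + 1) / μ)
  -- In order: the arc, the truncation of the Gamma integrals at `δ`, and the Taylor remainder.
  refine ⟨C₁ * (δ * |ψ|) + (∑ s ∈ Finset.range S, (2 / ρ) ^ s * (C₂ *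
        (Real.exp (δ ^ μ) * (Real.Gamma (((s : ℝ) + 1) / μ) / μ)))) +
      (2 / ρ) ^ S * (Real.Gamma (((S : ℝ) + 1) / μ) / μ), fun Q F K N hQ hK hN hF => ?_⟩
  have hρ : 0 < ρ := hδ.trans hδρ
  have hK0 : 0 ≤ K := (norm_nonneg _).trans (hK 0 (Metric.mem_ball_self hρ))
  have ha := norm_primitive_arc_le hδ hδρ hψ hω hω' hK (by linarith) hF
  have hb := norm_primitive_ray_sub_le hμ hδ hδρ hω hω' S hQ hK hN hF
  have ha' := ha.trans (mul_le_mul_of_nonneg_right (h₁ N hN) (by positivity))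
  have hb' := hb.trans (add_le_add_left (Finset.sum_le_sum fun s _ =>
    mul_le_mul_of_nonneg_left (mul_le_mul_of_nonneg_right (h₂ N hN) (by
      have : 0 ≤ Real.Gamma (((s : ℝ) + 1) / μ) := Real.Gamma_nonneg_of_nonneg (by positivity)
      positivity)) (by positivity)) _)
  refine (norm_sub_le_norm_sub_add_norm_sub _ (F (δ * ω) - F 0) _).trans ?_
  rw [sub_sub_sub_cancel_right]
  refine (add_le_add ha' hb').trans_eq ?_
  rw [add_mul, add_mul, Finset.sum_mul, ← add_assoc]
  congr 1
  · congr 1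
    · ring
    · exact Finset.sum_congr rfl fun s _ => by ring
  · ring

/-! ### The local coordinate -/

/-- The local inverse of `w z = (z - z₀) * u z`, with the bounds and relations needed to change
variables in contour integrals. -/
lemma exists_local_inverse {z₀ : ℂ} {u : ℂ → ℂ} (hu : AnalyticAt ℂ u z₀) (hu₀ : u z₀ ≠ 0)
    {V : Set ℂ} (hV : V ∈ 𝓝 z₀) :
    ∃ (ρ M : ℝ) (g : ℂ → ℂ), 0 < ρ ∧ DifferentiableOn ℂ g (Metric.ball 0 ρ) ∧
      MapsTo g (Metric.ball 0 ρ) V ∧ (∀ w ∈ Metric.ball (0 : ℂ) ρ, ‖deriv g w‖ ≤ M) ∧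
      ∀ᶠ z in 𝓝 z₀, (z - z₀) * u z ∈ Metric.ball 0 ρ ∧ g ((z - z₀) * u z) = z ∧
        DifferentiableAt ℂ u z ∧
        deriv g ((z - z₀) * u z) * deriv (fun z => (z - z₀) * u z) z = 1 := by
  set W : ℂ → ℂ := fun z => (z - z₀) * u z with hWdef
  have hW : AnalyticAt ℂ W z₀ := AnalyticAt.fun_mul (by fun_prop) hu
  have hW0 : W z₀ = 0 := by simp [hWdef]
  have hW' : deriv W z₀ ≠ 0 := by
    rw [hWdef, (hasDerivAt_sub_mul hu.differentiableAt).deriv]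
    simpa using hu₀
  set g := hW.hasStrictDerivAt.localInverse _ _ _ hW'
  have hg : AnalyticAt ℂ g 0 := hW0 ▸ hW.analyticAt_localInverse hW'
  have hinv : ∀ᶠ z in 𝓝 z₀, g (W z) = z :=
    HasStrictDerivAt.eventually_left_inverse hW.hasStrictDerivAt hW'
  have hg0 : g 0 = z₀ := by simpa [hW0] using hinv.self_of_nhds
  have hV' : ∀ᶠ w in 𝓝 (0 : ℂ), g w ∈ V := hg.continuousAt.eventually_mem (by rwa [hg0])
  have hM : ∀ᶠ w in 𝓝 (0 : ℂ), ‖deriv g w‖ < ‖deriv g 0‖ + 1 :=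
    hg.deriv.continuousAt.norm.eventually_lt_const (lt_add_one _)
  obtain ⟨ρ, hρ, hb⟩ := Metric.eventually_nhds_iff_ball.1
    (hV'.and (hM.and hg.eventually_analyticAt))
  refine ⟨ρ, ‖deriv g 0‖ + 1, g, hρ,
    fun w hw => (hb w hw).2.2.differentiableAt.differentiableWithinAt,
    fun w hw => (hb w hw).1, fun w hw => (hb w hw).2.1.le, ?_⟩
  have hball : ∀ᶠ z in 𝓝 z₀, W z ∈ Metric.ball 0 ρ :=
    hW.continuousAt.eventually_mem (by rw [hW0]; exact Metric.ball_mem_nhds 0 hρ)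
  filter_upwards [hball, hinv.eventually_nhds, hu.eventually_analyticAt] with z hz hgz huz
  refine ⟨hz, hgz.self_of_nhds, huz.differentiableAt, ?_⟩
  -- The last relation is the derivative of `g (W z) = z`, valid in a neighborhood of `z`.
  have h1 : HasDerivAt (fun z => g (W z)) (deriv g (W z) * deriv W z) z :=
    ((hb _ hz).2.2.differentiableAt.hasDerivAt).comp z
      (hasDerivAt_sub_mul huz.differentiableAt).differentiableAt.hasDerivAt
  exact (h1.congr_of_eventuallyEq (f₁ := id) (hgz.mono fun y hy => hy.symm)).unique (hasDerivAt_id z)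

lemma cpow_natCast_inv_eq {x : ℂ} (hx : x ≠ 0) (μ : ℕ) :
    x ^ ((μ : ℂ)⁻¹) = (‖x‖ ^ ((μ : ℝ)⁻¹) : ℝ) * Complex.exp ((x.arg / μ : ℝ) * Complex.I) := by
  rw [Complex.cpow_def_of_ne_zero hx, Real.rpow_def_of_pos (norm_pos_iff.2 hx), Complex.ofReal_exp,
    ← Complex.exp_add, Complex.log]
  push_cast
  ring_nf

/-- In the coordinate `w` the sector of arrival or departure is `|arg (w / ω)| < π / (2 μ)`. -/
lemma exists_polar_of_mem_sector {z₀ z p₀ v : ℂ} {μ : ℕ} (hμ : 1 ≤ μ) (hp₀ : p₀ ≠ 0) {k : ℤ}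
    (hz : z ∈ sector z₀ (steepestAngle μ p₀ k) (2 * Real.pi / μ)) (hv : 0 < v.re)
    (hre : 0 < (p₀ * (z - z₀) ^ μ * v).re) :
    ∃ δ ψ : ℝ, 0 < δ ∧ |μ * ψ| < Real.pi / 2 ∧
      (z - z₀) * (p₀ ^ ((μ : ℂ)⁻¹) * v ^ ((μ : ℂ)⁻¹)) =
        δ * Complex.exp (ψ * Complex.I) * Complex.exp (2 * Real.pi * Complex.I * k / μ) := by
  obtain ⟨r, θ, hr, hθ, rfl⟩ := hz
  have hμ0 : (0 : ℝ) < μ := by exact_mod_cast hμ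
  have hμC : (μ : ℂ) ≠ 0 := by exact_mod_cast hμ0.ne'
  have hv0 : v ≠ 0 := by rintro rfl; simp at hv
  have harg : |v.arg| < Real.pi / 2 := Complex.abs_arg_lt_pi_div_two_iff.2 (Or.inl hv)
  set ψ : ℝ := θ - steepestAngle μ p₀ k + v.arg / μ with hψ
  set δ : ℝ := r * ‖p₀‖ ^ ((μ : ℝ)⁻¹) * ‖v‖ ^ ((μ : ℝ)⁻¹) with hδ
  have hδ0 : 0 < δ := by positivity
  have hW : (z₀ + r * Complex.exp (θ * Complex.I) - z₀) * (p₀ ^ ((μ : ℂ)⁻¹) * v ^ ((μ : ℂ)⁻¹)) =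
      δ * Complex.exp (ψ * Complex.I) * Complex.exp (2 * Real.pi * Complex.I * k / μ) := by
    have hexp : Complex.exp (θ * Complex.I) * Complex.exp ((p₀.arg / μ : ℝ) * Complex.I) *
        Complex.exp ((v.arg / μ : ℝ) * Complex.I) =
        Complex.exp (ψ * Complex.I) * Complex.exp (2 * Real.pi * Complex.I * k / μ) := by
      rw [← Complex.exp_add, ← Complex.exp_add, ← Complex.exp_add, hψ, steepestAngle]
      congr 1
      push_cast
      field_simp
      ring
    rw [cpow_natCast_inv_eq hp₀, cpow_natCast_inv_eq hv0, mul_assoc (δ : ℂ), ← hexp, hδ]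
    push_cast
    ring
  refine ⟨δ, ψ, hδ0, ?_, hW⟩
  have hpow : p₀ * (z₀ + r * Complex.exp (θ * Complex.I) - z₀) ^ μ * v =
      (δ ^ μ : ℝ) * Complex.exp ((μ * ψ : ℝ) * Complex.I) := by
    have h1 := congrArg (· ^ μ) hW
    simp only [mul_pow, Complex.cpow_nat_inv_pow _ (Nat.one_le_iff_ne_zero.1 hμ)] at h1
    rw [← Complex.exp_nat_mul, ← Complex.exp_nat_mul, mul_div_cancel₀ _ hμC,
      show (2 * Real.pi * Complex.I * k : ℂ) = k * (2 * Real.pi * Complex.I) by ring,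
      Complex.exp_int_mul_two_pi_mul_I, mul_one] at h1
    push_cast
    rw [mul_assoc (μ : ℂ), ← h1]
    ring
  have hcos : 0 < Real.cos (μ * ψ) := by
    rw [hpow, Complex.re_ofReal_mul, Complex.exp_ofReal_mul_I_re] at hre
    exact (pos_iff_pos_of_mul_pos hre).1 (by positivity)
  -- The sector gives `π` and `arg v` at most `π / 2`. In this range the cosine is positive only for
  -- `|μ * ψ| < π / 2`, which excludes the neighboring valleys.
  have hbd : |μ * ψ| ≤ Real.pi + Real.pi / 2 := by
    rw [abs_mul, abs_of_pos hμ0]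
    have h1 : |ψ| ≤ Real.pi / μ + (Real.pi / 2) / μ := by
      refine (abs_add_le _ _).trans (add_le_add ?_ ?_)
      · rw [show Real.pi / μ = 2 * Real.pi / μ / 2 by ring]
        exact hθ.le
      · rw [abs_div, abs_of_pos hμ0]
        gcongr
    calc μ * |ψ| ≤ μ * (Real.pi / μ + (Real.pi / 2) / μ) := by gcongr
      _ = _ := by field_simp
  by_contra! hge
  have := Real.cos_nonpos_of_pi_div_two_le_of_le hge (by linarith)
  rw [Real.cos_abs] at this
  linarith

/-- The coefficients `α_s` are the Taylor coefficients in the coordinate `w`, up to `1 / μ`. -/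
lemma perronCoeff_eq_taylorQuot {z₀ p₀ : ℂ} {μ : ℕ} {φ q g : ℂ → ℂ} {ρ : ℝ} (hρ : 0 < ρ)
    (hφ : AnalyticAt ℂ φ z₀) (hφ₀ : φ z₀ = 0) (hp₀ : p₀ ≠ 0)
    {Q : ℂ → ℂ} (hQ : DifferentiableOn ℂ Q (Metric.ball 0 ρ))
    (hQg : ∀ w, Q w = q (g w) * deriv g w)
    (hg : ∀ᶠ z in 𝓝 z₀,
      g ((z - z₀) * (p₀ ^ ((μ : ℂ)⁻¹) * (1 - φ z) ^ ((μ : ℂ)⁻¹))) = z ∧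
      deriv g ((z - z₀) * (p₀ ^ ((μ : ℂ)⁻¹) * (1 - φ z) ^ ((μ : ℂ)⁻¹))) *
        deriv (fun z => (z - z₀) * (p₀ ^ ((μ : ℂ)⁻¹) * (1 - φ z) ^ ((μ : ℂ)⁻¹))) z = 1)
    (s : ℕ) : perronCoeff μ p₀ φ q z₀ s = taylorQuot Q s 0 / μ := by
  set u : ℂ → ℂ := fun z => p₀ ^ ((μ : ℂ)⁻¹) * (1 - φ z) ^ ((μ : ℂ)⁻¹) with hudef
  have hu : AnalyticAt ℂ u z₀ :=
    analyticAt_const.fun_mul ((analyticAt_const.fun_sub hφ).cpow analyticAt_const (by simp [hφ₀]))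
  have hu₀ : u z₀ ≠ 0 := by simp [hudef, hφ₀, Complex.cpow_eq_zero_iff, hp₀]
  have hR : AnalyticAt ℂ (fun z => taylorQuot Q (s + 1) ((z - z₀) * u z)) z₀ := by
    refine AnalyticAt.fun_comp (g := taylorQuot Q (s + 1)) ?_ (AnalyticAt.fun_mul (by fun_prop) hu)
    rw [sub_self, zero_mul]
    exact (differentiableOn_taylorQuot hρ hQ (s + 1)).analyticAt (Metric.ball_mem_nhds 0 hρ)
  have key := iteratedDeriv_inversion (q := q) hu hu₀ hR (fun j => taylorQuot Q j 0) s (by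
    filter_upwards [hg] with z hz
    rw [← eq_sum_add_taylorQuot Q (s + 1) ((z - z₀) * u z), hQg, hz.1, mul_assoc, hz.2, mul_one])
  -- Integer powers of a principal root are principal powers. The factors `p₀` and `1 - φ` keep
  -- separate roots because principal powers need not be multiplicative.
  have hpw : ∀ x : ℂ, x ^ (-((s : ℂ) + 1) / (μ : ℂ)) = ((x ^ ((μ : ℂ)⁻¹)) ^ (s + 1))⁻¹ := by
    intro x
    rw [← Complex.cpow_nat_mul, ← Complex.cpow_neg]
    congr 1
    push_cast
    ring
  have hfun : (fun z => q z * (u z ^ (s + 1))⁻¹) = fun z => p₀ ^ (-((s : ℂ) + 1) / (μ : ℂ)) *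
      (q z * (1 - φ z) ^ (-((s : ℂ) + 1) / (μ : ℂ))) := by
    funext z
    rw [hpw, hpw, hudef, mul_pow, mul_inv]
    ring
  have hs : (s.factorial : ℂ) ≠ 0 := by exact_mod_cast s.factorial_ne_zero
  rw [hfun, iteratedDeriv_const_mul_field] at key
  rw [perronCoeff, mul_assoc, key]
  field_simp

/-! ### Contour integrals -/

lemma IsContour.intervalIntegrable_mul {c : ℝ → ℂ} (hc : IsContour c) {f : ℂ → ℂ}
    (hf : ContinuousOn f (c '' Icc 0 1)) {a b : ℝ} (ha : 0 ≤ a) (hab : a ≤ b) (hb : b ≤ 1) :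
    IntervalIntegrable (fun t => f (c t) * deriv c t) MeasureTheory.volume a b := by
  have h : IntervalIntegrable (fun t => f (c t) * deriv c t) MeasureTheory.volume 0 1 :=
    hc.integrable_deriv.continuousOn_mul (by
      rw [uIcc_of_le zero_le_one]
      exact hf.comp hc.continuousOn (mapsTo_image c _))
  refine h.mono_set ?_
  rw [uIcc_of_le hab, uIcc_of_le zero_le_one]
  exact Icc_subset_Icc ha hb

lemma IsContour.exists_hasDerivAt {c : ℝ → ℂ} (hc : IsContour c) :
    ∃ F : Set ℝ, F.Countable ∧ ∀ t ∈ Ioo (0 : ℝ) 1 \ F, HasDerivAt c (deriv c t) t := by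
  obtain ⟨F, hF⟩ := hc.contDiffOn
  refine ⟨F, F.countable_toSet, fun t ht => ?_⟩
  have hopen : IsOpen (Ioo (0 : ℝ) 1 \ (F : Set ℝ)) := isOpen_Ioo.sdiff F.finite_toSet.isClosed
  exact ((hF.differentiableOn one_ne_zero).differentiableAt (hopen.mem_nhds ht)).hasDerivAt

/-- A part of the contour away from the maximum contributes an exponentially small amount. -/
lemma IsContour.exists_norm_integral_le {c : ℝ → ℂ} (hc : IsContour c) {p : ℂ → ℂ} {m : ℝ}
    (hp : ContinuousOn p (c '' Icc 0 1)) {a b : ℝ} (ha : 0 ≤ a) (hab : a ≤ b) (hb : b ≤ 1)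
    (hlt : ∀ t ∈ Icc a b, (p (c t)).re < m) (A : ℝ) :
    ∃ C : ℝ, ∀ (q : ℂ → ℂ) (K N : ℝ), (∀ z ∈ c '' Icc 0 1, ‖q z‖ ≤ K) → 1 ≤ N →
      ‖∫ t in a..b, Complex.exp (N * p (c t)) * q (c t) * deriv c t‖ ≤
        Real.exp (N * m) * (C * (K / N ^ A)) := by
  have hsub : Icc a b ⊆ Icc 0 1 := Icc_subset_Icc ha hb
  have hcont : ContinuousOn (fun t => (p (c t)).re) (Icc a b) :=
    Complex.continuous_re.comp_continuousOn
      ((hp.comp hc.continuousOn (mapsTo_image c _)).mono hsub)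
  -- Compactness turns the strict inequality into a gap `m - Re p (c x) > 0`, the exponential rate.
  obtain ⟨x, hx, hmax⟩ := isCompact_Icc.exists_isMaxOn (nonempty_Icc.2 hab) hcont
  obtain ⟨C, -, hC⟩ := exists_exp_neg_le_div_rpow (sub_pos.2 (hlt x hx)) A
  refine ⟨C * ∫ t in a..b, ‖deriv c t‖, fun q K N hK hN => ?_⟩
  have hK0 : 0 ≤ K := (norm_nonneg _).trans (hK (c 0) ⟨0, by simp, rfl⟩)
  have hint : IntervalIntegrable (fun t => ‖deriv c t‖) MeasureTheory.volume a b := by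
    refine (hc.integrable_deriv.mono_set ?_).norm
    rwa [uIcc_of_le hab, uIcc_of_le zero_le_one]
  have h := intervalIntegral.norm_integral_le_of_norm_le hab (μ := MeasureTheory.volume)
    (f := fun t => Complex.exp (N * p (c t)) * q (c t) * deriv c t)
    (g := fun t => Real.exp (N * m) * (C / N ^ A) * K * ‖deriv c t‖)
    (Eventually.of_forall fun t ht => by
      have ht' : t ∈ Icc a b := ⟨ht.1.le, ht.2⟩
      have h1 : (p (c t)).re ≤ (p (c x)).re := hmax ht'
      have h2 : ‖Complex.exp (N * p (c t))‖ ≤ Real.exp (N * m) * (C / N ^ A) := by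
        rw [Complex.norm_exp, Complex.re_ofReal_mul]
        refine le_trans ?_ (mul_le_mul_of_nonneg_left (hC N hN) (Real.exp_nonneg _))
        rw [← Real.exp_add]
        refine Real.exp_le_exp.2 ?_
        have := mul_le_mul_of_nonneg_left h1 (by linarith : 0 ≤ N)
        linarith
      rw [norm_mul, norm_mul]
      have h3 := hK (c t) ⟨t, hsub ht', rfl⟩
      have h4 : 0 ≤ Real.exp (N * m) * (C / N ^ A) := (norm_nonneg _).trans h2
      gcongr) (hint.const_mul _)
  refine h.trans_eq ?_
  rw [intervalIntegral.integral_const_mul]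
  ring

/-- Change of variables: the part of the contour near the maximum, in the coordinate `w`. -/
lemma IsContour.integral_eq_primitive_sub {c : ℝ → ℂ} (hc : IsContour c) {z₀ : ℂ} {p q g u : ℂ → ℂ}
    {F : ℂ → ℂ} {μ : ℕ} {ρ N : ℝ} {a b : ℝ} (ha : 0 < a) (hab : a ≤ b) (hb : b < 1)
    (hint : IntervalIntegrable (fun t => Complex.exp (N * p (c t)) * q (c t) * deriv c t)
      MeasureTheory.volume a b)
    (hloc : ∀ t ∈ Icc a b, (c t - z₀) * u (c t) ∈ Metric.ball 0 ρ ∧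
      g ((c t - z₀) * u (c t)) = c t ∧ DifferentiableAt ℂ u (c t) ∧
      deriv g ((c t - z₀) * u (c t)) * deriv (fun z => (z - z₀) * u z) (c t) = 1)
    (hpu : ∀ t ∈ Icc a b, p (c t) = p z₀ - ((c t - z₀) * u (c t)) ^ μ)
    (hF : ∀ w ∈ Metric.ball (0 : ℂ) ρ,
      HasDerivAt F (Complex.exp (-(N * w ^ μ)) * (q (g w) * deriv g w)) w) :
    ∫ t in a..b, Complex.exp (N * p (c t)) * q (c t) * deriv c t =
      Complex.exp (N * p z₀) *
        (F ((c b - z₀) * u (c b)) - F ((c a - z₀) * u (c a))) := by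
  obtain ⟨T, hT, hTd⟩ := hc.exists_hasDerivAt
  have hFW : ∀ t ∈ Icc a b, HasDerivAt (fun z => Complex.exp (N * p z₀) * F ((z - z₀) * u z))
      (Complex.exp (N * p (c t)) * q (c t)) (c t) := fun t ht => by
    obtain ⟨h1, h2, h3, h4⟩ := hloc t ht
    have hW := (hasDerivAt_sub_mul (z₀ := z₀) h3).differentiableAt.hasDerivAt
    refine (((hF _ h1).comp (c t) hW).const_mul (Complex.exp (N * p z₀))).congr_deriv ?_
    rw [h2, mul_assoc (Complex.exp (-_)), mul_assoc (q _), h4, mul_one, ← mul_assoc,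
      ← Complex.exp_add, hpu t ht]
    ring_nf
  rw [mul_sub]
  -- The fundamental theorem allows the finitely many corners of `c`.
  refine MeasureTheory.integral_eq_of_hasDerivAt_off_countable_of_le
    (fun t => Complex.exp (N * p z₀) * F ((c t - z₀) * u (c t))) _ hab hT ?_ (fun t ht => ?_) hint
  · intro t ht
    exact (hFW t ht).continuousAt.comp_continuousWithinAt
      ((hc.continuousOn t ⟨ha.le.trans ht.1, ht.2.trans hb.le⟩).mono
        (Icc_subset_Icc ha.le hb.le))
  · exact (hFW t ⟨ht.1.1.le, ht.1.2.le⟩).comp t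
      (hTd t ⟨⟨ha.trans ht.1.1, ht.1.2.trans hb⟩, ht.2⟩)

/-! ### Assembly of the expansion -/

theorem corollary1p4
    -- the neighborhood `B` of `z₀`, and the function `p` on the domain `D`
    (z₀ : ℂ) (B D : Set ℂ) (c : ℝ → ℂ) (p : ℂ → ℂ)
    (hB : B ∈ 𝓝 z₀) (hc : IsContour c)
    (hDo : IsOpen D) (hDc : IsConnected D) (hBD : B ∪ c '' Icc 0 1 ⊆ D)
    (hp : DifferentiableOn ℂ p D)
    -- the local form of `p` at `z₀`
    (μ : ℕ) (hμ : 1 ≤ μ) (p₀ : ℂ) (hp₀ : p₀ ≠ 0) (φ : ℂ → ℂ)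
    (hφ : AnalyticOnNhd ℂ φ B) (hφ₀ : φ z₀ = 0)
    (hpφ : ∀ z ∈ B, p z = p z₀ - p₀ * (z - z₀) ^ μ * (1 - φ z))
    -- the contour passes through `z₀` at the interior time `t₀` (and only then)
    (t₀ : ℝ) (ht₀ : t₀ ∈ Ioo (0 : ℝ) 1) (hct₀ : c t₀ = z₀)
    (honce : ∀ t ∈ Icc (0 : ℝ) 1, c t = z₀ → t = t₀)
    (hends : c 0 ≠ c 1)
    -- `Re p` is maximal at `z₀` only
    (hmax : ∀ z ∈ c '' Icc 0 1, z ≠ z₀ → (p z).re < (p z₀).re)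
    -- the sectors of arrival and departure
    (k₁ k₂ : ℤ)
    (harr : ∀ᶠ t in 𝓝[<] t₀, c t ∈ sector z₀ (steepestAngle μ p₀ k₁) (2 * Real.pi / μ))
    (hdep : ∀ᶠ t in 𝓝[>] t₀, c t ∈ sector z₀ (steepestAngle μ p₀ k₂) (2 * Real.pi / μ))
    (S : ℕ) :
    ∃ C N₀ : ℝ, 0 < N₀ ∧
      ∀ (q : ℂ → ℂ) (U : Set ℂ), IsOpen U → IsConnected U → B ∪ c '' Icc 0 1 ⊆ U →
        DifferentiableOn ℂ q U →
      ∀ K : ℝ, (∀ z ∈ B ∪ c '' Icc 0 1, ‖q z‖ ≤ K) →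
      ∀ N : ℝ, N₀ ≤ N →
        ∃ E : ℂ, ‖E‖ ≤ C * (K / N ^ (((S : ℝ) + 1) / (μ : ℝ))) ∧
          contourIntegral (fun z => Complex.exp (N * p z) * q z) c =
            Complex.exp (N * p z₀) *
              ((∑ s ∈ Finset.range S,
                (Real.Gamma (((s : ℝ) + 1) / (μ : ℝ)) : ℂ) *
                  (perronCoeff μ p₀ φ q z₀ s *
                    (Complex.exp (2 * Real.pi * Complex.I * k₂ * ((s : ℂ) + 1) / μ) -
                      Complex.exp (2 * Real.pi * Complex.I * k₁ * ((s : ℂ) + 1) / μ)) /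
                    ((N ^ (((s : ℝ) + 1) / (μ : ℝ)) : ℝ) : ℂ))) + E) := by
  have hμ0 : μ ≠ 0 := Nat.one_le_iff_ne_zero.1 hμ
  have hμC : (μ : ℂ) ≠ 0 := by exact_mod_cast hμ0
  have hφz : AnalyticAt ℂ φ z₀ := hφ z₀ (mem_of_mem_nhds hB)
  set u : ℂ → ℂ := fun z => p₀ ^ ((μ : ℂ)⁻¹) * (1 - φ z) ^ ((μ : ℂ)⁻¹) with hudef
  have hu : AnalyticAt ℂ u z₀ :=
    analyticAt_const.fun_mul ((analyticAt_const.fun_sub hφz).cpow analyticAt_const (by simp [hφ₀]))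
  have hu₀ : u z₀ ≠ 0 := by simp [hudef, hφ₀, Complex.cpow_eq_zero_iff, hp₀]
  obtain ⟨ρ, M, g, hρ, hgd, hgB, hgM, hloc⟩ := exists_local_inverse hu hu₀ hB
  have hpW : ∀ z ∈ B, p z = p z₀ - ((z - z₀) * u z) ^ μ := fun z hz => by
    rw [hpφ z hz, mul_pow, hudef, mul_pow, Complex.cpow_nat_inv_pow _ hμ0,
      Complex.cpow_nat_inv_pow _ hμ0]
    ring
  have hre1 : ∀ᶠ z in 𝓝 z₀, 0 < (1 - φ z).re := by
    have hcont : ContinuousAt (fun z => (1 - φ z).re) z₀ :=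
      Complex.continuous_re.continuousAt.comp (continuousAt_const.sub hφz.continuousAt)
    exact hcont.eventually_const_lt (by simp [hφ₀])
  have hct : ContinuousAt c t₀ := hc.continuousOn.continuousAt (Icc_mem_nhds ht₀.1 ht₀.2)
  -- Local facts at `z₀` are pulled back to times near `t₀` by continuity of `c`.
  rw [← hct₀] at hloc hre1 hB
  obtain ⟨ε, hε, hball⟩ := Metric.eventually_nhds_iff_ball.1
    (((hct.eventually hloc).and ((hct.eventually hre1).and (hct.eventually hB))).and
      (Ioo_mem_nhds ht₀.1 ht₀.2))
  rw [hct₀] at hball hloc hre1 hB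
  obtain ⟨t₁, ht₁s, ht₁⟩ := (harr.and (Ioo_mem_nhdsLT (sub_lt_self t₀ hε))).exists
  obtain ⟨t₂, ht₂s, ht₂⟩ := (hdep.and (Ioo_mem_nhdsGT (lt_add_of_pos_right t₀ hε))).exists
  have hnear : ∀ t ∈ Icc t₁ t₂, t ∈ Metric.ball t₀ ε := fun t ht => by
    rw [Real.ball_eq_Ioo]
    exact ⟨ht₁.1.trans_le ht.1, ht.2.trans_lt ht₂.2⟩
  have ht₁₂ : t₁ ≤ t₂ := (ht₁.2.trans ht₂.1).le
  have hm₁ : t₁ ∈ Icc t₁ t₂ := left_mem_Icc.2 ht₁₂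
  have hm₂ : t₂ ∈ Icc t₁ t₂ := right_mem_Icc.2 ht₁₂
  have h0t₁ : 0 < t₁ := (hball t₁ (hnear t₁ hm₁)).2.1
  have ht₂1 : t₂ < 1 := (hball t₂ (hnear t₂ hm₂)).2.2
  have hlt : ∀ t ∈ Icc (0 : ℝ) 1, t ≠ t₀ → (p (c t)).re < (p z₀).re := fun t ht hne =>
    hmax _ ⟨t, ht, rfl⟩ fun h => hne (honce t ht h)
  have hpolar : ∀ t ∈ Icc t₁ t₂, t ≠ t₀ → ∀ k : ℤ,
      c t ∈ sector z₀ (steepestAngle μ p₀ k) (2 * Real.pi / μ) →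
      ∃ δ ψ : ℝ, 0 < δ ∧ δ < ρ ∧ |μ * ψ| < Real.pi / 2 ∧ (c t - z₀) * u (c t) =
        δ * Complex.exp (ψ * Complex.I) * Complex.exp (2 * Real.pi * Complex.I * k / μ) := by
    intro t ht hne k hk
    obtain ⟨⟨hl, hr, hb⟩, h01⟩ := hball t (hnear t ht)
    have hpos : 0 < (p₀ * (c t - z₀) ^ μ * (1 - φ (c t))).re := by
      have := hlt t ⟨h01.1.le, h01.2.le⟩ hne
      rw [hpφ _ hb, Complex.sub_re] at this
      linarith
    obtain ⟨δ, ψ, hδ, hψ, hW⟩ := exists_polar_of_mem_sector hμ hp₀ hk hr hpos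
    refine ⟨δ, ψ, hδ, ?_, hψ, hW⟩
    have hmem := hl.1
    rw [hudef, hW, mem_ball_zero_iff, norm_mul, norm_mul, Complex.norm_exp_ofReal_mul_I,
      show (2 * Real.pi * Complex.I * k / μ : ℂ) = (2 * Real.pi * k / μ : ℝ) * Complex.I by
        push_cast; ring, Complex.norm_exp_ofReal_mul_I, Complex.norm_real,
      Real.norm_of_nonneg hδ.le, mul_one, mul_one] at hmem
    exact hmem
  have hroot : ∀ k : ℤ, Complex.exp (2 * Real.pi * Complex.I * k / μ) ^ μ = 1 := fun k => by
    rw [← Complex.exp_nat_mul, mul_div_cancel₀ _ hμC,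
      show (2 * Real.pi * Complex.I * k : ℂ) = k * (2 * Real.pi * Complex.I) by ring,
      Complex.exp_int_mul_two_pi_mul_I]
  have hrootn : ∀ k : ℤ, ‖Complex.exp (2 * Real.pi * Complex.I * k / μ)‖ = 1 := fun k =>
    Complex.norm_eq_one_of_pow_eq_one (hroot k) hμ0
  obtain ⟨δ₁, ψ₁, hδ₁, hδρ₁, hψ₁, hW₁⟩ := hpolar t₁ hm₁ ht₁.2.ne k₁ ht₁s
  obtain ⟨δ₂, ψ₂, hδ₂, hδρ₂, hψ₂, hW₂⟩ := hpolar t₂ hm₂ ht₂.1.ne' k₂ ht₂s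
  obtain ⟨C₁, hC₁⟩ :=
    exists_norm_primitive_sub_le hμ hδ₁ hδρ₁ hψ₁ (hroot k₁) (hrootn k₁) S
  obtain ⟨C₂, hC₂⟩ :=
    exists_norm_primitive_sub_le hμ hδ₂ hδρ₂ hψ₂ (hroot k₂) (hrootn k₂) S
  have hpc : ContinuousOn p (c '' Icc 0 1) :=
    hp.continuousOn.mono (subset_union_right.trans hBD)
  obtain ⟨C₃, hC₃⟩ := hc.exists_norm_integral_le hpc le_rfl h0t₁.le (ht₁₂.trans ht₂1.le)
    (fun t ht => hlt t ⟨ht.1, ht.2.trans (ht₁₂.trans ht₂1.le)⟩ (ht.2.trans_lt ht₁.2).ne)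
    (((S : ℝ) + 1) / μ)
  obtain ⟨C₄, hC₄⟩ := hc.exists_norm_integral_le hpc (h0t₁.le.trans ht₁₂) ht₂1.le le_rfl
    (fun t ht => hlt t ⟨h0t₁.le.trans (ht₁₂.trans ht.1), ht.2⟩ (ht₂.1.trans_le ht.1).ne')
    (((S : ℝ) + 1) / μ)
  -- Two outer pieces and two endpoints; `M` bounds `g'`, so that `‖Q‖ ≤ M * K`. Every constant is
  -- fixed before `q`, `K` and `N`.
  refine ⟨C₃ + C₄ + (C₂ * M + C₁ * M), 1, one_pos, fun q U hU _ hBU hq K hK N hN => ?_⟩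
  set Q : ℂ → ℂ := fun w => q (g w) * deriv g w with hQdef
  have hQ : DifferentiableOn ℂ Q (Metric.ball 0 ρ) :=
    (hq.comp hgd fun w hw => hBU (Or.inl (hgB hw))).fun_mul (hgd.deriv Metric.isOpen_ball)
  have hQK : ∀ w ∈ Metric.ball (0 : ℂ) ρ, ‖Q w‖ ≤ M * K := fun w hw => by
    rw [hQdef, norm_mul, mul_comm]
    have h1 := hgM w hw
    exact mul_le_mul h1 (hK _ (Or.inl (hgB hw))) (norm_nonneg _) ((norm_nonneg _).trans h1)
  obtain ⟨F, hF⟩ : ∃ F : ℂ → ℂ, ∀ w ∈ Metric.ball (0 : ℂ) ρ,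
      HasDerivAt F (Complex.exp (-(N * w ^ μ)) * Q w) w := by
    have hd : DifferentiableOn ℂ (fun w => Complex.exp (-(N * w ^ μ)) * Q w) (Metric.ball 0 ρ) :=
      DifferentiableOn.fun_mul (by fun_prop) hQ
    exact hd.isExactOn_ball
  have hcoeff : ∀ s, perronCoeff μ p₀ φ q z₀ s = taylorQuot Q s 0 / μ :=
    perronCoeff_eq_taylorQuot hρ hφz hφ₀ hp₀ hQ (fun w => rfl)
      (hloc.mono fun z hz => ⟨hz.2.1, hz.2.2.2⟩)
  have hqc : ContinuousOn q (c '' Icc 0 1) :=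
    hq.continuousOn.mono (subset_union_right.trans hBU)
  have hfc : ContinuousOn (fun z => Complex.exp (N * p z) * q z) (c '' Icc 0 1) :=
    (Complex.continuous_exp.comp_continuousOn (continuousOn_const.mul hpc)).mul hqc
  have hi₁ := hc.intervalIntegrable_mul hfc le_rfl h0t₁.le (ht₁₂.trans ht₂1.le)
  have hi₂ := hc.intervalIntegrable_mul hfc h0t₁.le ht₁₂ ht₂1.le
  have hi₃ := hc.intervalIntegrable_mul hfc (h0t₁.le.trans ht₁₂) ht₂1.le le_rfl
  have hmid := hc.integral_eq_primitive_sub (z₀ := z₀) (u := u) (g := g) (F := F) (μ := μ)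
    (ρ := ρ) h0t₁ ht₁₂ ht₂1 hi₂ (fun t ht => (hball t (hnear t ht)).1.1)
    (fun t ht => hpW _ (hball t (hnear t ht)).1.2.2) hF
  have hKc : ∀ z ∈ c '' Icc 0 1, ‖q z‖ ≤ K := fun z hz => hK z (Or.inr hz)
  have hb₁ := hC₁ Q F (M * K) N hQ hQK hN hF
  have hb₂ := hC₂ Q F (M * K) N hQ hQK hN hF
  have hb₃ := hC₃ q K N hKc hN
  have hb₄ := hC₄ q K N hKc hN
  rw [hW₁, hW₂] at hmid
  set w₁ : ℂ := δ₁ * Complex.exp (ψ₁ * Complex.I) * Complex.exp (2 * Real.pi * Complex.I * k₁ / μ)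
  set w₂ : ℂ := δ₂ * Complex.exp (ψ₂ * Complex.I) * Complex.exp (2 * Real.pi * Complex.I * k₂ / μ)
  set A₁ : ℂ := ∑ s ∈ Finset.range S, taylorQuot Q s 0 *
    Complex.exp (2 * Real.pi * Complex.I * k₁ / μ) ^ (s + 1) *
      ((Real.Gamma (((s : ℝ) + 1) / μ) / μ / N ^ (((s : ℝ) + 1) / μ) : ℝ) : ℂ) with hA₁
  set A₂ : ℂ := ∑ s ∈ Finset.range S, taylorQuot Q s 0 *
    Complex.exp (2 * Real.pi * Complex.I * k₂ / μ) ^ (s + 1) *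
      ((Real.Gamma (((s : ℝ) + 1) / μ) / μ / N ^ (((s : ℝ) + 1) / μ) : ℝ) : ℂ) with hA₂
  have hsum : (∑ s ∈ Finset.range S,
      (Real.Gamma (((s : ℝ) + 1) / (μ : ℝ)) : ℂ) *
        (perronCoeff μ p₀ φ q z₀ s *
          (Complex.exp (2 * Real.pi * Complex.I * k₂ * ((s : ℂ) + 1) / μ) -
            Complex.exp (2 * Real.pi * Complex.I * k₁ * ((s : ℂ) + 1) / μ)) /
          ((N ^ (((s : ℝ) + 1) / (μ : ℝ)) : ℝ) : ℂ))) = A₂ - A₁ := by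
    have hexp : ∀ (k : ℤ) (s : ℕ), Complex.exp (2 * Real.pi * Complex.I * k / μ) ^ (s + 1) =
        Complex.exp (2 * Real.pi * Complex.I * k * ((s : ℂ) + 1) / μ) := fun k s => by
      rw [← Complex.exp_nat_mul]
      congr 1
      push_cast
      ring
    rw [hA₁, hA₂, ← Finset.sum_sub_distrib]
    refine Finset.sum_congr rfl fun s _ => ?_
    rw [hcoeff, hexp, hexp]
    push_cast
    ring
  rw [hsum]
  set I₁ := ∫ t in (0 : ℝ)..t₁, Complex.exp (N * p (c t)) * q (c t) * deriv c t
  set I₃ := ∫ t in t₂..(1 : ℝ), Complex.exp (N * p (c t)) * q (c t) * deriv c t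
  have hsplit : contourIntegral (fun z => Complex.exp (N * p z) * q z) c =
      I₁ + Complex.exp (N * p z₀) * (F w₂ - F w₁) + I₃ := by
    rw [contourIntegral, ← intervalIntegral.integral_add_adjacent_intervals (hi₁.trans hi₂) hi₃,
      ← intervalIntegral.integral_add_adjacent_intervals hi₁ hi₂, hmid]
  -- The outer pieces enter `E` divided by `exp (N * p z₀)`.
  have hcancel : Complex.exp (N * p z₀) * Complex.exp (-(N * p z₀)) = 1 := by
    rw [← Complex.exp_add, add_neg_cancel, Complex.exp_zero]
  have hsmall : ∀ (I : ℂ) (C : ℝ), ‖I‖ ≤ Real.exp (N * (p z₀).re) * C →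
      ‖Complex.exp (-(N * p z₀)) * I‖ ≤ C := fun I C h => by
    rw [norm_mul, Complex.norm_exp, Complex.neg_re, Complex.re_ofReal_mul, Real.exp_neg]
    exact inv_mul_le_of_le_mul₀ (Real.exp_nonneg _)
      (nonneg_of_mul_nonneg_right ((norm_nonneg _).trans h) (Real.exp_pos _)) h
  refine ⟨Complex.exp (-(N * p z₀)) * I₁ + Complex.exp (-(N * p z₀)) * I₃ +
    ((F w₂ - F 0 - A₂) - (F w₁ - F 0 - A₁)), ?_, ?_⟩
  · refine (norm_add_le_of_le (norm_add_le_of_le (hsmall _ _ hb₃) (hsmall _ _ hb₄))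
      (norm_sub_le_of_le hb₂ hb₁)).trans_eq ?_
    ring
  · rw [hsplit]
    linear_combination (-(I₁ + I₃)) * hcancel
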